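/- An XOR game is given by $m\in\mathbb{N}$, a probability distribution $P$ on $[m]\times[m]$ and a function $f:[m]\times[m]\to\{0,1\}$: questions $(x,y)$ are drawn from $P$, Alice sees $x$ and answers a bit $a$, Bob sees $y$ and answers a bit $b$, and they win if $a\oplus b=f(x,y)$. Its game matrix is the real $m\times m$ matrix $\tilde\Phi=\sum_{x,y}(-1)^{f(x,y)}P(x,y)\,|x\rangle\langle y|$. The classical value $\omega_c$ is the maximum winning probability over deterministic strategies $a=\alpha(x)$, $b=\beta(y)$; such a strategy is represented by the matrix $S_c=|s^A\rangle\langle s^B|$, where $s^A_x=(-1)^{\alpha(x)}$ and $s^B_y=(-1)^{\beta(y)}$. The quantum value $\omega_q$ is the supremum of the winning probability over all finite-dimensional quantum strategies, in which Alice and Bob measure $\pm1$-valued observables $A_x$ and $B_y$ on their respective parts of a shared pure state $|\psi\rangle\in\mathbb{C}^{d_A}\otimes\mathbb{C}^{d_B}$. **Theorem.** Let $\tilde\Phi$ be the game matrix of an XOR game, with no all-zero row or column, and let $S_c=|s^A\rangle\langle s^B|$ represent an optimal classical strategy (one with winning probability $\omega_c$). Put $$\Sigma=\operatorname{diag}\big(\{\langle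 i|\tilde\Phi|s^B\rangle\langle s^A|i\rangle\}_{i=1}^m\big),\qquad \Lambda=\operatorname{diag}\big(\{\langle s^A|\tilde\Phi|i\rangle\langle i|s^B\rangle\}_{i=1}^m\big).$$ Then $\omega_q=\omega_c$ if and only if $\Sigma$ and $\Lambda$ are both positive definite or both negative definite, and in addition $$\rho\big(\Lambda^{-1}\tilde\Phi^T\Sigma^{-1}\tilde\Phi\big)=1,$$ where $\rho$ denotes the spectral radius, i.e. the largest modulus of a complex eigenvalue. -/

import Mathlib

open scoped Matrix Kronecker

noncomputable section

/-- The sign `(-1)^b` of an answer bit `b` (`false` is the bit `0`, `true` is the bit `1`). -/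
def bitSign (b : Bool) : ℝ := if b then -1 else 1

/-- A two-party XOR game with questions `x, y ∈ [m]`: a probability distribution `P` on the pairs of
questions, and a binary function `f`; the players win when `a ⊕ b = f x y`. -/
structure XorGame (m : ℕ) where
  f : Fin m → Fin m → Bool
  P : Fin m → Fin m → ℝ
  P_nonneg : ∀ x y, 0 ≤ P x y
  P_sum : ∑ x, ∑ y, P x y = 1

/-- A quantum strategy: a shared pure state `ψ ∈ ℂ^dA ⊗ ℂ^dB` and, for each question, a
`±1`-valued observable (a Hermitian operator with square one) on the local space of the player. -/
structure QuantumStrategy (m dA dB : ℕ) where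
  ψ : Fin dA × Fin dB → ℂ
  ψ_unit : star ψ ⬝ᵥ ψ = 1
  A : Fin m → Matrix (Fin dA) (Fin dA) ℂ
  B : Fin m → Matrix (Fin dB) (Fin dB) ℂ
  A_herm : ∀ x, (A x).IsHermitian
  B_herm : ∀ y, (B y).IsHermitian
  A_sq : ∀ x, A x * A x = 1
  B_sq : ∀ y, B y * B y = 1

/-- The projector `(1 + (-1)^a A) / 2` onto the eigenspace of the `±1`-valued observable `A` that
corresponds to the answer bit `a`. -/
def outcomeProj {d : ℕ} (A : Matrix (Fin d) (Fin d) ℂ) (a : Bool) : Matrix (Fin d) (Fin d) ℂ :=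
  (1 / 2 : ℂ) • (1 + (bitSign a : ℂ) • A)

/-- The probability of the answers `a, b` to the questions `x, y` (Born rule). -/
def QuantumStrategy.prob {m dA dB : ℕ} (S : QuantumStrategy m dA dB)
    (x y : Fin m) (a b : Bool) : ℝ :=
  (star S.ψ ⬝ᵥ ((outcomeProj (S.A x) a ⊗ₖ outcomeProj (S.B y) b) *ᵥ S.ψ)).re

namespace XorGame

variable {m : ℕ}

/-- The game matrix, with entries `(-1)^(f x y) * P x y`. -/
def gameMatrix (G : XorGame m) : Matrix (Fin m) (Fin m) ℝ :=
  Matrix.of fun x y => bitSign (G.f x y) * G.P x y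

/-- The probability of winning with the deterministic answers `α x` and `β y`. -/
def classicalWinProb (G : XorGame m) (α β : Fin m → Bool) : ℝ :=
  ∑ x, ∑ y, G.P x y * (if xor (α x) (β y) = G.f x y then 1 else 0)

/-- The probability of winning with a given quantum strategy. -/
def quantumWinProb (G : XorGame m) {dA dB : ℕ} (S : QuantumStrategy m dA dB) : ℝ :=
  ∑ x, ∑ y, G.P x y *
    ∑ a : Bool, ∑ b : Bool, (if xor a b = G.f x y then S.prob x y a b else 0)

/-- The classical value `ω_c`. -/
def classicalValue (G : XorGame m) : ℝ :=
  sSup {w : ℝ | ∃ α β : Fin m → Bool, w = G.classicalWinProb α β}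

/-- The quantum value `ω_q`: the supremum over quantum strategies of all finite dimensions. -/
def quantumValue (G : XorGame m) : ℝ :=
  sSup {w : ℝ | ∃ (dA dB : ℕ) (S : QuantumStrategy m dA dB), w = G.quantumWinProb S}

/-- The classical strategy given by the answers `α`, `β` is optimal. -/
def IsOptimalClassical (G : XorGame m) (α β : Fin m → Bool) : Prop :=
  ∀ α' β' : Fin m → Bool, G.classicalWinProb α' β' ≤ G.classicalWinProb α β

/-- The diagonal matrix with entries `⟨i|Φ|sB⟩⟨sA|i⟩`. -/
def sigmaMat (G : XorGame m) (sA sB : Fin m → ℝ) : Matrix (Fin m) (Fin m) ℝ :=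
  Matrix.diagonal fun i => (G.gameMatrix *ᵥ sB) i * sA i

/-- The diagonal matrix with entries `⟨sA|Φ|i⟩⟨i|sB⟩`. -/
def lambdaMat (G : XorGame m) (sA sB : Fin m → ℝ) : Matrix (Fin m) (Fin m) ℝ :=
  Matrix.diagonal fun i => (sA ᵥ* G.gameMatrix) i * sB i

end XorGame

/-- The spectral radius of a real square matrix: the largest modulus of its complex eigenvalues. -/
def realSpectralRadius {m : ℕ} (M : Matrix (Fin m) (Fin m) ℝ) : ENNReal :=
  spectralRadius ℂ (M.map (fun r : ℝ => (r : ℂ)))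

end

open scoped Matrix Kronecker

/-! By linearity the bias of a strategy is the form `∑ M x y * corr x y`, where `M` is the game
matrix. Quantum correlations are real inner products of unit vectors, classical ones products of
signs. Both sides of the equivalence amount to positive semidefiniteness of the block matrix with
diagonal blocks `Σ`, `Λ` and off-diagonal blocks `-M`, `-Mᵀ` (`DiagDominates`).

If it holds, applying it to each coordinate of the vectors bounds every quantum bias by half of `tr
Σ + tr Λ`, which is the classical bias (`DiagDominates.sum_mul_corr_le`). Conversely, if the signs
are optimal among quantum strategies, rotating them slightly in a plane, which two qubits can
realize, gives it as the second-order condition (`diagDominates_of_planar_optimal`); nonzero rows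
and columns then force positive diagonals.

For positive `Σ`, `Λ`, it says that `Σ^(-1/2) M Λ^(-1/2)` is a contraction, i.e. that the spectrum
of `Λ⁻¹ Mᵀ Σ⁻¹ M` lies in the unit disc. The vector `s^B` always has eigenvalue 1, so the spectral
radius is then exactly 1. -/

/-- `2 uᵀ M v ≤ ∑ σ u² + ∑ τ v²` for all real `u`, `v`, i.e. the block matrix with diagonal blocks
`diag σ`, `diag τ` and off-diagonal blocks `-M`, `-Mᵀ` is positive semidefinite. -/
def DiagDominates {ι : Type*} [Fintype ι] (M : Matrix ι ι ℝ) (σ τ : ι → ℝ) : Prop :=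
  ∀ u v : ι → ℝ, 2 * ∑ x, ∑ y, M x y * (u x * v y) ≤ ∑ x, σ x * u x ^ 2 + ∑ y, τ y * v y ^ 2

/-! ### Diagonal domination and the spectrum of the normalized matrix. -/

theorem mem_spectrum_iff_exists_mulVec {ι : Type*} [Fintype ι] [DecidableEq ι]
    (M : Matrix ι ι ℂ) (k : ℂ) : k ∈ spectrum ℂ M ↔ ∃ v, v ≠ 0 ∧ M *ᵥ v = k • v := by
  rw [spectrum.mem_iff, Matrix.isUnit_iff_isUnit_det, isUnit_iff_ne_zero, not_not,
    ← Matrix.exists_mulVec_eq_zero_iff]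
  refine exists_congr fun v => and_congr_right fun _ => ?_
  rw [Matrix.sub_mulVec, Algebra.algebraMap_eq_smul_one, Matrix.smul_mulVec, Matrix.one_mulVec,
    sub_eq_zero, eq_comm]

theorem mulVec_normalized_apply {ι 𝕜 : Type*} [Fintype ι] [DecidableEq ι] [RCLike 𝕜]
    (M : Matrix ι ι ℝ) {σ τ : ι → ℝ} (hσ : ∀ x, 0 < σ x) (hτ : ∀ y, 0 < τ y) (z : ι → 𝕜) (y : ι) :
    ((((Matrix.diagonal τ)⁻¹ * Mᵀ * (Matrix.diagonal σ)⁻¹ * M).map (fun r : ℝ => (r : 𝕜))) *ᵥ z) y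
      = (τ y : 𝕜)⁻¹ * ∑ x, (M x y : 𝕜) * ((σ x : 𝕜)⁻¹ * ∑ y', (M x y' : 𝕜) * z y') := by
  have hinv : ∀ ρ : ι → ℝ, (∀ x, 0 < ρ x) →
      (Matrix.diagonal ρ)⁻¹ = Matrix.diagonal fun x => (ρ x)⁻¹ := fun ρ hρ => by
    refine Matrix.inv_eq_right_inv ?_
    rw [Matrix.diagonal_mul_diagonal, ← Matrix.diagonal_one]
    congr 1
    funext x
    exact mul_inv_cancel₀ (hρ x).ne'
  have hmap : ((Matrix.diagonal τ)⁻¹ * Mᵀ * (Matrix.diagonal σ)⁻¹ * M).map (fun r : ℝ => (r : 𝕜))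
      = Matrix.diagonal (fun x => (τ x : 𝕜)⁻¹) * (Mᵀ.map (fun r : ℝ => (r : 𝕜))
        * (Matrix.diagonal (fun x => (σ x : 𝕜)⁻¹) * M.map (fun r : ℝ => (r : 𝕜)))) := by
    rw [hinv σ hσ, hinv τ hτ, Matrix.mul_assoc, Matrix.mul_assoc]
    ext i j
    simp [Matrix.mul_apply, Matrix.diagonal_apply]
  rw [hmap, ← Matrix.mulVec_mulVec, ← Matrix.mulVec_mulVec, ← Matrix.mulVec_mulVec,
    Matrix.mulVec_diagonal]
  simp only [Matrix.mulVec, dotProduct, Matrix.map_apply, Matrix.transpose_apply]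
  congr 1
  refine Finset.sum_congr rfl fun x _ => ?_
  rw [← Matrix.mulVec_diagonal (fun x => (σ x : 𝕜)⁻¹) (fun x => ∑ y', (M x y' : 𝕜) * z y') x]
  rfl

theorem DiagDominates.sum_re_le {ι : Type*} [Fintype ι] {M : Matrix ι ι ℝ} {σ τ : ι → ℝ}
    (h : DiagDominates M σ τ) (u v : ι → ℂ) :
    2 * ∑ x, ∑ y, M x y * ((u x).re * (v y).re + (u x).im * (v y).im)
      ≤ ∑ x, σ x * Complex.normSq (u x) + ∑ y, τ y * Complex.normSq (v y) := by
  have h1 := h (fun x => (u x).re) (fun x => (v x).re)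
  have h2 := h (fun x => (u x).im) (fun x => (v x).im)
  simp only [mul_add, Finset.sum_add_distrib, Complex.normSq_apply, ← pow_two]
  linarith

/-- For an eigenvector `z` put `w = Σ⁻¹ M z`. The weighted square norms `W` of `w` and `L` of `z`
satisfy `k L = W`, and domination at `(w, z)` reads `2 W ≤ W + L`. -/
theorem DiagDominates.norm_le_one_of_mem_spectrum {ι : Type*} [Fintype ι] [DecidableEq ι]
    {M : Matrix ι ι ℝ} {σ τ : ι → ℝ} (hσ : ∀ x, 0 < σ x) (hτ : ∀ y, 0 < τ y)
    (h : DiagDominates M σ τ) {k : ℂ}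
    (hk : k ∈ spectrum ℂ (((Matrix.diagonal τ)⁻¹ * Mᵀ * (Matrix.diagonal σ)⁻¹ * M).map
      (fun r : ℝ => (r : ℂ)))) : ‖k‖ ≤ 1 := by
  obtain ⟨z, hz, he⟩ := (mem_spectrum_iff_exists_mulVec _ _).1 hk
  set w : ι → ℂ := fun x => (σ x : ℂ)⁻¹ * ∑ y, (M x y : ℂ) * z y with hw
  have hw' : ∀ x, (σ x : ℂ) * w x = ∑ y, (M x y : ℂ) * z y := fun x => by
    rw [hw]
    exact mul_inv_cancel_left₀ (by exact_mod_cast (hσ x).ne') _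
  have hz' : ∀ y, ∑ x, (M x y : ℂ) * w x = k * (τ y * z y) := fun y => by
    have h1 := congrFun he y
    have h2 := mulVec_normalized_apply (𝕜 := ℂ) M hσ hτ z y
    have h3 : (τ y : ℂ) ≠ 0 := by exact_mod_cast (hτ y).ne'
    have h4 : (τ y : ℂ)⁻¹ * ∑ x, (M x y : ℂ) * w x = k * z y := h2.symm.trans h1
    rw [inv_mul_eq_iff_eq_mul₀ h3] at h4
    rw [h4]; ring
  set W : ℝ := ∑ x, σ x * Complex.normSq (w x) with hW
  set L : ℝ := ∑ y, τ y * Complex.normSq (z y) with hL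
  have hLpos : 0 < L := by
    obtain ⟨y, hy⟩ := Function.ne_iff.1 hz
    exact Finset.sum_pos' (fun y _ => mul_nonneg (hτ y).le (Complex.normSq_nonneg _))
      ⟨y, Finset.mem_univ y, mul_pos (hτ y) (Complex.normSq_pos.2 hy)⟩
  have hWnn : 0 ≤ W := Finset.sum_nonneg fun y _ => mul_nonneg (hσ y).le (Complex.normSq_nonneg _)
  have e1 : (W : ℂ) = ∑ x, ∑ y, (M x y : ℂ) * (star (w x) * z y) := by
    rw [hW]; push_cast
    refine Finset.sum_congr rfl fun x _ => ?_
    rw [Complex.normSq_eq_conj_mul_self, mul_left_comm, hw' x, Finset.mul_sum]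
    refine Finset.sum_congr rfl fun y _ => ?_
    rw [mul_left_comm]; rfl
  have e2 : k * (L : ℂ) = ∑ x, ∑ y, (M x y : ℂ) * (w x * star (z y)) := by
    rw [Finset.sum_comm, hL]; push_cast
    rw [Finset.mul_sum]
    refine Finset.sum_congr rfl fun y _ => ?_
    rw [Complex.normSq_eq_conj_mul_self]
    calc k * ((τ y : ℂ) * ((starRingEnd ℂ) (z y) * z y))
        = (k * (τ y * z y)) * star (z y) := by rw [Complex.star_def]; ring
      _ = _ := by rw [← hz' y, Finset.sum_mul]; exact Finset.sum_congr rfl fun x _ => by ring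
  -- The sums in `e1` and `e2` are conjugate since `M` is real, and `W` is real.
  have e3 : k * (L : ℂ) = W := by
    rw [e2, ← Complex.conj_ofReal W, e1]
    simp [mul_comm]
  have e4 : W = ∑ x, ∑ y, M x y * ((w x).re * (z y).re + (w x).im * (z y).im) := by
    have := congrArg Complex.re e1
    rw [Complex.ofReal_re] at this
    rw [this]
    simp
  have h5 := h.sum_re_le w z
  rw [← e4, ← hW, ← hL] at h5
  have h6 : ‖k‖ * L = W := by
    have := congrArg norm e3
    rwa [norm_mul, Complex.norm_real, Complex.norm_real, Real.norm_of_nonneg hLpos.le,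
      Real.norm_of_nonneg hWnn] at this
  refine le_of_mul_le_mul_right ?_ hLpos
  linarith

/-- `Rᵀ R` is similar to the normalized matrix through `diag √τ`, so its eigenvalues are at most 1
and `R` is a contraction; completing the square in `u` then gives domination. -/
theorem diagDominates_of_norm_le_one {ι : Type*} [Fintype ι] [DecidableEq ι]
    {M : Matrix ι ι ℝ} {σ τ : ι → ℝ} (hσ : ∀ x, 0 < σ x) (hτ : ∀ y, 0 < τ y)
    (h : ∀ k ∈ spectrum ℂ (((Matrix.diagonal τ)⁻¹ * Mᵀ * (Matrix.diagonal σ)⁻¹ * M).map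
      (fun r : ℝ => (r : ℂ))), ‖k‖ ≤ 1) : DiagDominates M σ τ := by
  set R : Matrix ι ι ℝ := Matrix.of fun x y => (√(σ x))⁻¹ * M x y * (√(τ y))⁻¹ with hR
  have hRM : ∀ x y, M x y = √(σ x) * R x y * √(τ y) := fun x y => by
    have := (Real.sqrt_pos.2 (hσ x)).ne'
    have := (Real.sqrt_pos.2 (hτ y)).ne'
    simp only [hR, Matrix.of_apply]
    field_simp
  have hH : (1 - Rᵀ * R).IsHermitian :=
    Matrix.isHermitian_one.sub (by simpa using Matrix.isHermitian_conjTranspose_mul_self R)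
  have hpsd : (1 - Rᵀ * R).PosSemidef := by
    rw [hH.posSemidef_iff_eigenvalues_nonneg]
    intro i
    have hv := hH.mulVec_eigenvectorBasis i
    set μ := hH.eigenvalues i
    set v : ι → ℝ := (hH.eigenvectorBasis i).ofLp with hvdef
    have hv0 : v ≠ 0 := fun h0 => hH.eigenvectorBasis.orthonormal.ne_zero i (by
      apply (WithLp.ofLp_injective 2); exact h0)
    have hK : ∀ y, ∑ x, R x y * ∑ y', R x y' * v y' = (1 - μ) * v y := fun y => by
      have h1 := congrFun hv y
      rw [Matrix.sub_mulVec, Matrix.one_mulVec, ← Matrix.mulVec_mulVec] at h1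
      have h2 : (Rᵀ *ᵥ R *ᵥ v) y = ∑ x, R x y * ∑ y', R x y' * v y' := rfl
      rw [← h2]
      simp only [Pi.sub_apply, Pi.smul_apply, smul_eq_mul] at h1
      linarith
    -- An eigenvalue `μ` of `1 - Rᵀ R` becomes an eigenvalue `1 - μ` of the normalized matrix, with
    -- eigenvector `z`.
    set z : ι → ℝ := fun y => (√(τ y))⁻¹ * v y with hz
    have hzv : ∀ y, √(τ y) * z y = v y := fun y =>
      mul_inv_cancel_left₀ (Real.sqrt_pos.2 (hτ y)).ne' _
    have hz0 : z ≠ 0 := fun h0 => hv0 (by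
      funext y
      rw [← hzv y, h0]; simp)
    have hreal : ∀ y, (τ y)⁻¹ * ∑ x, M x y * ((σ x)⁻¹ * ∑ y', M x y' * z y') = (1 - μ) * z y := by
      intro y
      have h1 : ∀ x, M x y * ((σ x)⁻¹ * ∑ y', M x y' * z y')
          = √(τ y) * (R x y * ∑ y', R x y' * v y') := fun x => by
        have h2 : ∑ y', M x y' * z y' = √(σ x) * ∑ y', R x y' * v y' := by
          rw [Finset.mul_sum]
          refine Finset.sum_congr rfl fun y' _ => ?_
          rw [hRM x y', ← hzv y']; ring
        have h3 : √(σ x) * √(σ x) * (σ x)⁻¹ = 1 := by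
          rw [Real.mul_self_sqrt (hσ x).le, mul_inv_cancel₀ (hσ x).ne']
        rw [h2, hRM x y]
        linear_combination (R x y * √(τ y) * ∑ y', R x y' * v y') * h3
      rw [Finset.sum_congr rfl fun x _ => h1 x, ← Finset.mul_sum, hK y, ← hzv y]
      have h3 : √(τ y) * √(τ y) * (τ y)⁻¹ = 1 := by
        rw [Real.mul_self_sqrt (hτ y).le, mul_inv_cancel₀ (hτ y).ne']
      linear_combination ((1 - μ) * z y) * h3
    have hmem := h ((1 - μ : ℝ) : ℂ) ((mem_spectrum_iff_exists_mulVec _ _).2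
      ⟨fun y => (z y : ℂ), fun h0 => hz0 (by
        funext y
        exact Complex.ofReal_injective (congrFun h0 y)), by
        funext y
        have h1 := mulVec_normalized_apply (𝕜 := ℂ) M hσ hτ (fun y => (z y : ℂ)) y
        refine h1.trans ?_
        have h2 := congrArg (fun r : ℝ => (r : ℂ)) (hreal y)
        push_cast at h2
        simpa using h2⟩)
    rw [Complex.norm_real, Real.norm_eq_abs, abs_le] at hmem
    exact sub_le_self_iff _ |>.1 hmem.2
  intro u v
  have h1 := hpsd.dotProduct_mulVec_nonneg (fun y => √(τ y) * v y)
  have h2 : 0 ≤ ∑ y, τ y * v y ^ 2 - ∑ x, (∑ y, R x y * (√(τ y) * v y)) ^ 2 := by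
    rw [Matrix.sub_mulVec, Matrix.one_mulVec, ← Matrix.mulVec_mulVec, dotProduct_sub,
      Matrix.dotProduct_mulVec, Matrix.vecMul_transpose] at h1
    have h3 : ∑ y, τ y * v y ^ 2 = ∑ y, √(τ y) * v y * (√(τ y) * v y) := by
      refine Finset.sum_congr rfl fun y _ => ?_
      nth_rewrite 1 [← Real.mul_self_sqrt (hτ y).le]
      ring
    rw [h3]
    simp only [pow_two]
    exact h1
  have h3 : ∀ x, 2 * ∑ y, M x y * (u x * v y)
      ≤ σ x * u x ^ 2 + (∑ y, R x y * (√(τ y) * v y)) ^ 2 := fun x => by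
    have h4 : ∑ y, M x y * (u x * v y) = √(σ x) * u x * ∑ y, R x y * (√(τ y) * v y) := by
      rw [Finset.mul_sum]
      refine Finset.sum_congr rfl fun y _ => ?_
      rw [hRM x y]; ring
    rw [h4]
    have h5 := Real.mul_self_sqrt (hσ x).le
    nth_rewrite 2 [← h5]
    nlinarith [sq_nonneg (√(σ x) * u x - ∑ y, R x y * (√(τ y) * v y))]
  have h6 := Finset.sum_le_sum fun x (_ : x ∈ Finset.univ) => h3 x
  rw [← Finset.mul_sum, Finset.sum_add_distrib] at h6
  linarith

theorem bitSign_mul_self (b : Bool) : bitSign b * bitSign b = 1 := by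
  cases b <;> simp [bitSign]

/-! ### Quantum correlations as inner products of unit vectors. -/

namespace QuantumStrategy

/-- The state after applying Alice's observable. -/
def aliceVec {m dA dB : ℕ} (S : QuantumStrategy m dA dB) (x : Fin m) : Fin dA × Fin dB → ℂ :=
  (S.A x ⊗ₖ (1 : Matrix (Fin dB) (Fin dB) ℂ)) *ᵥ S.ψ

/-- The state after applying Bob's observable. -/
def bobVec {m dA dB : ℕ} (S : QuantumStrategy m dA dB) (y : Fin m) : Fin dA × Fin dB → ℂ :=
  ((1 : Matrix (Fin dA) (Fin dA) ℂ) ⊗ₖ S.B y) *ᵥ S.ψ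

/-- The correlation `⟨ψ|A_x ⊗ B_y|ψ⟩`. -/
def corr {m dA dB : ℕ} (S : QuantumStrategy m dA dB) (x y : Fin m) : ℝ :=
  (star S.ψ ⬝ᵥ ((S.A x ⊗ₖ S.B y) *ᵥ S.ψ)).re

variable {m dA dB : ℕ} (S : QuantumStrategy m dA dB)

theorem prob_eq (x y : Fin m) (a b : Bool) :
    S.prob x y a b = (1 / 4) * (1 + bitSign a * (star S.ψ ⬝ᵥ S.aliceVec x).re
      + bitSign b * (star S.ψ ⬝ᵥ S.bobVec y).re + bitSign a * bitSign b * S.corr x y) := by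
  have h : outcomeProj (S.A x) a ⊗ₖ outcomeProj (S.B y) b
      = (1 / 4 : ℂ) • (1 + (bitSign a : ℂ) • (S.A x ⊗ₖ (1 : Matrix (Fin dB) (Fin dB) ℂ))
        + (bitSign b : ℂ) • ((1 : Matrix (Fin dA) (Fin dA) ℂ) ⊗ₖ S.B y)
        + ((bitSign a * bitSign b : ℝ) : ℂ) • (S.A x ⊗ₖ S.B y)) := by
    rw [← Matrix.one_kronecker_one]
    ext ⟨i, j⟩ ⟨k, l⟩
    simp only [outcomeProj, Matrix.kroneckerMap_apply, Matrix.smul_apply, Matrix.add_apply,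
      smul_eq_mul]
    push_cast
    ring
  rw [prob, h]
  simp only [Matrix.smul_mulVec, Matrix.add_mulVec, Matrix.one_mulVec, dotProduct_smul,
    dotProduct_add, S.ψ_unit, smul_eq_mul]
  rw [show (1 / 4 : ℂ) = ((1 / 4 : ℝ) : ℂ) by push_cast; rfl]
  simp only [Complex.re_ofReal_mul, Complex.add_re, Complex.one_re]
  rfl

/-- The marginal terms cancel, because the winning condition is invariant under flipping both
answers. -/
theorem sum_prob_eq (x y : Fin m) (c : Bool) :
    ∑ a : Bool, ∑ b : Bool, (if xor a b = c then S.prob x y a b else 0)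
      = 1 / 2 + 1 / 2 * (bitSign c * S.corr x y) := by
  cases c <;> simp [prob_eq, bitSign] <;> ring

theorem corr_eq_dotProduct (x y : Fin m) :
    S.corr x y = (star (S.aliceVec x) ⬝ᵥ S.bobVec y).re := by
  have h : S.A x ⊗ₖ S.B y = (S.A x ⊗ₖ (1 : Matrix (Fin dB) (Fin dB) ℂ))
      * ((1 : Matrix (Fin dA) (Fin dA) ℂ) ⊗ₖ S.B y) := by
    rw [← Matrix.mul_kronecker_mul, Matrix.mul_one, Matrix.one_mul]
  rw [corr, aliceVec, bobVec, h, ← Matrix.mulVec_mulVec, Matrix.dotProduct_mulVec,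
    Matrix.star_mulVec, Matrix.conjTranspose_kronecker, (S.A_herm x).eq, Matrix.conjTranspose_one]

theorem corr_eq_sum (x y : Fin m) : S.corr x y = ∑ k, ((S.aliceVec x k).re * (S.bobVec y k).re
    + (S.aliceVec x k).im * (S.bobVec y k).im) := by
  rw [corr_eq_dotProduct]
  simp [dotProduct]

theorem sum_normSq_eq_one_of_unit {ι : Type*} [Fintype ι] {v : ι → ℂ} (h : star v ⬝ᵥ v = 1) :
    ∑ k, Complex.normSq (v k) = 1 := by
  have h' := congrArg Complex.re h
  simpa [dotProduct, Complex.normSq_apply] using h'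

theorem sum_normSq_aliceVec (x : Fin m) : ∑ k, Complex.normSq (S.aliceVec x k) = 1 := by
  apply sum_normSq_eq_one_of_unit
  rw [aliceVec, Matrix.star_mulVec, Matrix.conjTranspose_kronecker, (S.A_herm x).eq,
    Matrix.conjTranspose_one, ← Matrix.dotProduct_mulVec, Matrix.mulVec_mulVec,
    ← Matrix.mul_kronecker_mul, S.A_sq, Matrix.one_mul, Matrix.one_kronecker_one,
    Matrix.one_mulVec, S.ψ_unit]

theorem sum_normSq_bobVec (y : Fin m) : ∑ k, Complex.normSq (S.bobVec y k) = 1 := by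
  apply sum_normSq_eq_one_of_unit
  rw [bobVec, Matrix.star_mulVec, Matrix.conjTranspose_kronecker, (S.B_herm y).eq,
    Matrix.conjTranspose_one, ← Matrix.dotProduct_mulVec, Matrix.mulVec_mulVec,
    ← Matrix.mul_kronecker_mul, S.B_sq, Matrix.one_mul, Matrix.one_kronecker_one,
    Matrix.one_mulVec, S.ψ_unit]

theorem abs_corr_le_one (x y : Fin m) : |S.corr x y| ≤ 1 := by
  have h1 := S.sum_normSq_aliceVec x
  have h2 := S.sum_normSq_bobVec y
  have h3 : |S.corr x y| ≤ ∑ k, (1 / 2) * (Complex.normSq (S.aliceVec x k)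
      + Complex.normSq (S.bobVec y k)) := by
    rw [corr_eq_sum]
    refine (Finset.abs_sum_le_sum_abs _ _).trans (Finset.sum_le_sum fun k _ => ?_)
    rw [abs_le, Complex.normSq_apply, Complex.normSq_apply]
    constructor
    · nlinarith [sq_nonneg ((S.aliceVec x k).re + (S.bobVec y k).re),
        sq_nonneg ((S.aliceVec x k).im + (S.bobVec y k).im)]
    · nlinarith [sq_nonneg ((S.aliceVec x k).re - (S.bobVec y k).re),
        sq_nonneg ((S.aliceVec x k).im - (S.bobVec y k).im)]
  rw [← Finset.mul_sum, Finset.sum_add_distrib, h1, h2] at h3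
  linarith

end QuantumStrategy

/-! ### Planar correlations realized on two qubits. -/

/-- The real reflection `c σ_z + d σ_x`. -/
def reflectionMatrix (c d : ℝ) : Matrix (Fin 2) (Fin 2) ℂ := !![(c : ℂ), d; d, -c]

theorem reflectionMatrix_isHermitian (c d : ℝ) : (reflectionMatrix c d).IsHermitian := by
  ext i j
  fin_cases i <;> fin_cases j <;> simp [reflectionMatrix]

theorem reflectionMatrix_mul_self {c d : ℝ} (h : c ^ 2 + d ^ 2 = 1) :
    reflectionMatrix c d * reflectionMatrix c d = 1 := by
  have h' : (c : ℂ) * c + d * d = 1 := by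
    rw [← pow_two, ← pow_two]; exact_mod_cast h
  ext i j
  fin_cases i <;> fin_cases j <;>
    simp [reflectionMatrix, h', mul_comm, add_comm ((d : ℂ) * d)]

/-- The maximally entangled state of two qubits. -/
noncomputable def bellState : Fin 2 × Fin 2 → ℂ := fun p => if p.1 = p.2 then ((√2)⁻¹ : ℝ) else 0

theorem inv_sqrt_two_mul_self : (((√2)⁻¹ : ℝ) : ℂ) * (((√2)⁻¹ : ℝ) : ℂ) = 1 / 2 := by
  rw [← Complex.ofReal_mul, ← mul_inv, Real.mul_self_sqrt (by norm_num)]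
  norm_num

/-- The strategy on a maximally entangled pair of qubits with prescribed real reflections. -/
noncomputable def qubitStrategy {m : ℕ} (c d c' d' : Fin m → ℝ) (h : ∀ x, c x ^ 2 + d x ^ 2 = 1)
    (h' : ∀ x, c' x ^ 2 + d' x ^ 2 = 1) : QuantumStrategy m 2 2 where
  ψ := bellState
  ψ_unit := by
    have := inv_sqrt_two_mul_self
    simp only [dotProduct, Fintype.sum_prod_type, Fin.sum_univ_two, bellState, Pi.star_apply,
      Complex.star_def]
    simp only [Complex.conj_ofReal, this, if_true, Fin.zero_eq_one_iff, Fin.one_eq_zero_iff]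
    norm_num [this]
  A x := reflectionMatrix (c x) (d x)
  B y := reflectionMatrix (c' y) (d' y)
  A_herm _ := reflectionMatrix_isHermitian _ _
  B_herm _ := reflectionMatrix_isHermitian _ _
  A_sq x := reflectionMatrix_mul_self (h x)
  B_sq y := reflectionMatrix_mul_self (h' y)

/-- On the maximally entangled state `⟨ψ|A ⊗ B|ψ⟩ = tr(A Bᵀ) / 2`, which for reflections is the
inner product of their parameter vectors. -/
theorem qubitStrategy_corr {m : ℕ} (c d c' d' : Fin m → ℝ) (h : ∀ x, c x ^ 2 + d x ^ 2 = 1)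
    (h' : ∀ x, c' x ^ 2 + d' x ^ 2 = 1) (x y : Fin m) :
    (qubitStrategy c d c' d' h h').corr x y = c x * c' y + d x * d' y := by
  have hs := inv_sqrt_two_mul_self
  have : star bellState ⬝ᵥ ((reflectionMatrix (c x) (d x) ⊗ₖ reflectionMatrix (c' y) (d' y)) *ᵥ
      bellState) = ((c x * c' y + d x * d' y : ℝ) : ℂ) := by
    simp only [dotProduct, Matrix.mulVec, Fintype.sum_prod_type, Fin.sum_univ_two, bellState,
      Pi.star_apply, Complex.star_def, Matrix.kroneckerMap_apply, reflectionMatrix]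
    generalize (((√2)⁻¹ : ℝ)) = r at hs
    simp
    linear_combination (2 * (c x * c' y + d x * d' y) : ℂ) * hs
  exact (congrArg Complex.re this).trans (Complex.ofReal_re _)

/-! ### Winning probabilities in terms of the game matrix. -/

namespace XorGame

variable {m : ℕ} (G : XorGame m)

theorem sum_P_mul_eq (r : Fin m → Fin m → ℝ) :
    ∑ x, ∑ y, G.P x y * (1 / 2 + 1 / 2 * (bitSign (G.f x y) * r x y))
      = 1 / 2 + 1 / 2 * ∑ x, ∑ y, G.gameMatrix x y * r x y := by
  have h : ∀ x y, G.P x y * (1 / 2 + 1 / 2 * (bitSign (G.f x y) * r x y))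
      = 1 / 2 * G.P x y + 1 / 2 * (G.gameMatrix x y * r x y) := fun x y => by
    simp only [gameMatrix, Matrix.of_apply]; ring
  simp only [h, Finset.sum_add_distrib, ← Finset.mul_sum, G.P_sum]
  ring

theorem classicalWinProb_eq (α β : Fin m → Bool) : G.classicalWinProb α β
    = 1 / 2 + 1 / 2 * ∑ x, ∑ y, G.gameMatrix x y * (bitSign (α x) * bitSign (β y)) := by
  rw [← sum_P_mul_eq, classicalWinProb]
  refine Finset.sum_congr rfl fun x _ => Finset.sum_congr rfl fun y _ => ?_
  congr 1
  cases α x <;> cases β y <;> cases G.f x y <;> norm_num [bitSign]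

theorem quantumWinProb_eq {dA dB : ℕ} (S : QuantumStrategy m dA dB) : G.quantumWinProb S
    = 1 / 2 + 1 / 2 * ∑ x, ∑ y, G.gameMatrix x y * S.corr x y := by
  rw [← sum_P_mul_eq, quantumWinProb]
  simp only [S.sum_prob_eq]

theorem quantumWinProb_le_quantumValue {dA dB : ℕ} (S : QuantumStrategy m dA dB) :
    G.quantumWinProb S ≤ G.quantumValue := by
  -- The supremum is usable only for a bounded set; correlations of modulus at most 1 supply the
  -- bound.
  refine le_csSup ⟨1 / 2 + 1 / 2 * ∑ x, ∑ y, |G.gameMatrix x y|, ?_⟩ ⟨dA, dB, S, rfl⟩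
  rintro _ ⟨dA, dB, S, rfl⟩
  rw [quantumWinProb_eq]
  gcongr with x _ y _
  refine (le_abs_self _).trans ?_
  rw [abs_mul]
  exact mul_le_of_le_one_right (abs_nonneg _) (S.abs_corr_le_one x y)

variable {G}

theorem IsOptimalClassical.classicalValue_eq {α β : Fin m → Bool} (h : G.IsOptimalClassical α β) :
    G.classicalValue = G.classicalWinProb α β := by
  refine IsGreatest.csSup_eq ⟨⟨α, β, rfl⟩, ?_⟩
  rintro _ ⟨α', β', rfl⟩
  exact h α' β'

theorem size_pos (G : XorGame m) : 0 < m := by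
  rcases Nat.eq_zero_or_pos m with rfl | h
  · simpa using G.P_sum
  · exact h

end XorGame

/-! ### Optimal sign vectors: the second-order condition and the eigenvalue 1. -/

section SignVectors

variable {ι : Type*} [Fintype ι] (M : Matrix ι ι ℝ) (s t : ι → ℝ)

theorem sum_mulVec_mul (g : ι → ℝ) :
    ∑ x, (M *ᵥ t) x * s x * g x = ∑ x, ∑ y, M x y * (s x * t y) * g x := by
  refine Finset.sum_congr rfl fun x _ => ?_
  simp only [Matrix.mulVec, dotProduct, Finset.sum_mul]
  exact Finset.sum_congr rfl fun y _ => by ring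

theorem sum_vecMul_mul (g : ι → ℝ) :
    ∑ y, (s ᵥ* M) y * t y * g y = ∑ x, ∑ y, M x y * (s x * t y) * g y := by
  rw [Finset.sum_comm]
  refine Finset.sum_congr rfl fun x _ => ?_
  simp only [Matrix.vecMul, dotProduct, Finset.sum_mul]
  exact Finset.sum_congr rfl fun y _ => by ring

variable {M s t}

/-- If the sign vectors `s`, `t` maximize the bilinear form of `M` even among pairs of families of
unit vectors in the plane, then second-order perturbation gives diagonal domination. -/
theorem diagDominates_of_planar_optimal (hs : ∀ x, s x * s x = 1) (ht : ∀ y, t y * t y = 1)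
    (h : ∀ c d c' d' : ι → ℝ, (∀ x, c x ^ 2 + d x ^ 2 = 1) → (∀ x, c' x ^ 2 + d' x ^ 2 = 1) →
      ∑ x, ∑ y, M x y * (c x * c' y + d x * d' y) ≤ ∑ x, ∑ y, M x y * (s x * t y)) :
    DiagDominates M (fun x => (M *ᵥ t) x * s x) (fun y => (s ᵥ* M) y * t y) := by
  intro u v
  -- `F r` is the change of the form divided by `r ^ 2`, in a shape that makes sense at `r = 0`,
  -- when each sign moves on the unit circle by the rational parametrization with parameter `r * u
  -- x` or `r * v y`.
  set F : ℝ → ℝ := fun r => ∑ x, ∑ y, M x y * ((4 * (u x * v y)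
    - 2 * (s x * t y) * (u x ^ 2 + v y ^ 2)) / ((1 + (r * u x) ^ 2) * (1 + (r * v y) ^ 2))) with hF
  have hne : ∀ q : ℝ, 1 + q ^ 2 ≠ 0 := fun q => by positivity
  have hunit : ∀ e q : ℝ, e * e = 1 →
      (e * (1 - q ^ 2) / (1 + q ^ 2)) ^ 2 + (2 * q / (1 + q ^ 2)) ^ 2 = 1 := fun e q he => by
    have := hne q
    field_simp
    linear_combination (1 - q ^ 2) ^ 2 * he
  have hFle : ∀ r : ℝ, r ≠ 0 → F r ≤ 0 := fun r hr => by
    have h1 := h _ _ _ _ (fun x => hunit (s x) (r * u x) (hs x))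
      (fun y => hunit (t y) (r * v y) (ht y))
    have h2 : r ^ 2 * F r = ∑ x, ∑ y, M x y *
        (s x * (1 - (r * u x) ^ 2) / (1 + (r * u x) ^ 2)
          * (t y * (1 - (r * v y) ^ 2) / (1 + (r * v y) ^ 2))
        + 2 * (r * u x) / (1 + (r * u x) ^ 2) * (2 * (r * v y) / (1 + (r * v y) ^ 2)))
        - ∑ x, ∑ y, M x y * (s x * t y) := by
      simp only [hF, Finset.mul_sum, ← Finset.sum_sub_distrib]
      refine Finset.sum_congr rfl fun x _ => Finset.sum_congr rfl fun y _ => ?_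
      have := hne (r * u x)
      have := hne (r * v y)
      field_simp
      ring
    by_contra hpos
    have := mul_pos (pow_pos (abs_pos.2 hr) 2) (not_le.1 hpos)
    rw [sq_abs] at this
    linarith
  have hcont : Continuous F := by
    refine continuous_finsetSum _ fun x _ => continuous_finsetSum _ fun y _ => ?_
    refine continuous_const.mul (continuous_const.div (by fun_prop) fun r => ?_)
    exact mul_ne_zero (hne _) (hne _)
  -- Optimality gives the sign only for `r ≠ 0`; continuity carries it to the second-order
  -- coefficient `F 0`.
  have h0 : F 0 ≤ 0 := le_of_tendsto (hcont.continuousAt.tendsto.mono_left nhdsWithin_le_nhds)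
    (eventually_mem_nhdsWithin.mono fun r (hr : r ∈ ({0}ᶜ : Set ℝ)) => hFle r hr)
  have h3 : F 0 = 4 * ∑ x, ∑ y, M x y * (u x * v y) - 2 * (∑ x, ∑ y, M x y * (s x * t y) * u x ^ 2
      + ∑ x, ∑ y, M x y * (s x * t y) * v y ^ 2) := by
    simp only [hF, Finset.mul_sum, ← Finset.sum_add_distrib, ← Finset.sum_sub_distrib]
    refine Finset.sum_congr rfl fun x _ => Finset.sum_congr rfl fun y _ => ?_
    simp
    ring
  rw [sum_mulVec_mul, sum_vecMul_mul]
  linarith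

theorem DiagDominates.left_pos {σ τ : ι → ℝ} (h : DiagDominates M σ τ)
    (hrow : ∀ x, ∃ y, M x y ≠ 0) (x : ι) : 0 < σ x := by
  classical
  have key : ∀ y (a b : ℝ), 2 * (M x y * (a * b)) ≤ σ x * a ^ 2 + τ y * b ^ 2 := fun y a b => by
    have h1 := h (Pi.single x a) (Pi.single y b)
    simpa [Pi.single_apply, ite_pow] using h1
  obtain ⟨y, hy⟩ := hrow x
  by_contra hn
  -- If `σ x ≤ 0`, this choice would give `2 * (|τ y| + 1) ≤ τ y`.
  have h1 := key y ((|τ y| + 1) / M x y) 1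
  have h2 : M x y * ((|τ y| + 1) / M x y * 1) = |τ y| + 1 := by field_simp
  rw [h2] at h1
  have h3 : σ x * ((|τ y| + 1) / M x y) ^ 2 ≤ 0 :=
    mul_nonpos_of_nonpos_of_nonneg (not_lt.1 hn) (sq_nonneg _)
  linarith [le_abs_self (τ y), abs_nonneg (τ y)]

theorem DiagDominates.transpose {σ τ : ι → ℝ} (h : DiagDominates M σ τ) :
    DiagDominates Mᵀ τ σ := by
  intro u v
  have h1 := h v u
  rw [Finset.sum_comm] at h1
  simp only [Matrix.transpose_apply, mul_comm (u _)]
  linarith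

theorem one_mem_spectrum_normalized [Nonempty ι] [DecidableEq ι] (hs : ∀ x, s x * s x = 1)
    (ht : ∀ y, t y * t y = 1) (hσ : ∀ x, 0 < (M *ᵥ t) x * s x) (hτ : ∀ y, 0 < (s ᵥ* M) y * t y) :
    (1 : ℂ) ∈ spectrum ℂ (((Matrix.diagonal fun y => (s ᵥ* M) y * t y)⁻¹ * Mᵀ
      * (Matrix.diagonal fun x => (M *ᵥ t) x * s x)⁻¹ * M).map (fun r : ℝ => (r : ℂ))) := by
  refine (mem_spectrum_iff_exists_mulVec _ _).2 ⟨fun y => (t y : ℂ), fun h0 => ?_, ?_⟩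
  · obtain ⟨i⟩ := ‹Nonempty ι›
    have h1 : t i = 0 := Complex.ofReal_injective (congrFun h0 i)
    simpa [h1] using ht i
  · funext y
    refine (mulVec_normalized_apply (𝕜 := ℂ) M hσ hτ (fun y => (t y : ℂ)) y).trans ?_
    have h1 : ∀ x, ((M *ᵥ t) x * s x)⁻¹ * ∑ y', M x y' * t y' = s x := fun x => by
      rw [inv_mul_eq_iff_eq_mul₀ (hσ x).ne', mul_assoc, hs, mul_one]; rfl
    have h2 : ((s ᵥ* M) y * t y)⁻¹ *
        ∑ x, M x y * (((M *ᵥ t) x * s x)⁻¹ * ∑ y', M x y' * t y') = t y := by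
      simp only [h1]
      rw [inv_mul_eq_iff_eq_mul₀ (hτ y).ne', mul_assoc, ht, mul_one]
      exact Finset.sum_congr rfl fun x _ => mul_comm _ _
    have h3 := congrArg (fun r : ℝ => (r : ℂ)) h2
    push_cast at h3
    simpa using h3

end SignVectors

/-! ### The dual bound on quantum correlations and the final equivalence. -/

theorem DiagDominates.sum_mul_corr_le {m dA dB : ℕ} {M : Matrix (Fin m) (Fin m) ℝ}
    {σ τ : Fin m → ℝ} (h : DiagDominates M σ τ) (S : QuantumStrategy m dA dB) :
    2 * ∑ x, ∑ y, M x y * S.corr x y ≤ ∑ x, σ x + ∑ y, τ y := by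
  have h1 := Finset.sum_le_sum fun k (_ : k ∈ Finset.univ) =>
    h.sum_re_le (fun x => S.aliceVec x k) (fun y => S.bobVec y k)
  have h2 : ∑ k, ∑ x, σ x * Complex.normSq (S.aliceVec x k) = ∑ x, σ x := by
    rw [Finset.sum_comm]
    simp only [← Finset.mul_sum, S.sum_normSq_aliceVec, mul_one]
  have h3 : ∑ k, ∑ y, τ y * Complex.normSq (S.bobVec y k) = ∑ y, τ y := by
    rw [Finset.sum_comm]
    simp only [← Finset.mul_sum, S.sum_normSq_bobVec, mul_one]
  rw [Finset.sum_add_distrib, h2, h3, ← Finset.mul_sum] at h1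
  refine le_trans (le_of_eq ?_) h1
  simp only [S.corr_eq_sum, Finset.mul_sum]
  rw [Finset.sum_comm_cycle]

theorem realSpectralRadius_le_one_iff {m : ℕ} (M : Matrix (Fin m) (Fin m) ℝ) :
    realSpectralRadius M ≤ 1 ↔ ∀ k ∈ spectrum ℂ (M.map (fun r : ℝ => (r : ℂ))), ‖k‖ ≤ 1 := by
  simp only [realSpectralRadius, spectralRadius, iSup_le_iff, ENNReal.coe_le_one_iff]
  rfl

theorem one_le_realSpectralRadius {m : ℕ} {M : Matrix (Fin m) (Fin m) ℝ}
    (h : (1 : ℂ) ∈ spectrum ℂ (M.map (fun r : ℝ => (r : ℂ)))) : 1 ≤ realSpectralRadius M := by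
  refine le_trans ?_ (le_iSup₂ (f := fun (k : ℂ) (_ : k ∈ spectrum ℂ _) => (‖k‖₊ : ENNReal)) 1 h)
  simp

theorem theorem1 {m : ℕ} (G : XorGame m)
    (hrow : ∀ x, ∃ y, G.gameMatrix x y ≠ 0) (hcol : ∀ y, ∃ x, G.gameMatrix x y ≠ 0)
    (α β : Fin m → Bool) (hopt : G.IsOptimalClassical α β)
    (sA sB : Fin m → ℝ) (hsA : ∀ x, sA x = bitSign (α x)) (hsB : ∀ y, sB y = bitSign (β y)) :
    G.quantumValue = G.classicalValue ↔
      (((G.sigmaMat sA sB).PosDef ∧ (G.lambdaMat sA sB).PosDef) ∨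
        ((-G.sigmaMat sA sB).PosDef ∧ (-G.lambdaMat sA sB).PosDef)) ∧
      realSpectralRadius ((G.lambdaMat sA sB)⁻¹ * G.gameMatrixᵀ * (G.sigmaMat sA sB)⁻¹ *
        G.gameMatrix) = 1 := by
  have hs : ∀ x, sA x * sA x = 1 := fun x => by rw [hsA, bitSign_mul_self]
  have ht : ∀ y, sB y * sB y = 1 := fun y => by rw [hsB, bitSign_mul_self]
  have : Nonempty (Fin m) := ⟨⟨0, G.size_pos⟩⟩
  set C := ∑ x, ∑ y, G.gameMatrix x y * (sA x * sB y) with hC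
  have hσC : ∑ x, (G.gameMatrix *ᵥ sB) x * sA x = C := by
    simpa using sum_mulVec_mul G.gameMatrix sA sB 1
  have hτC : ∑ y, (sA ᵥ* G.gameMatrix) y * sB y = C := by
    simpa using sum_vecMul_mul G.gameMatrix sA sB 1
  have hc : G.classicalValue = 1 / 2 + 1 / 2 * C := by
    rw [hopt.classicalValue_eq, G.classicalWinProb_eq, hC]
    simp only [hsA, hsB]
  have hplane : ∀ c d c' d' : Fin m → ℝ, (∀ x, c x ^ 2 + d x ^ 2 = 1) →
      (∀ x, c' x ^ 2 + d' x ^ 2 = 1) →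
      1 / 2 + 1 / 2 * ∑ x, ∑ y, G.gameMatrix x y * (c x * c' y + d x * d' y) ≤ G.quantumValue := by
    intro c d c' d' h h'
    have h1 := G.quantumWinProb_le_quantumValue (qubitStrategy c d c' d' h h')
    simpa only [G.quantumWinProb_eq, qubitStrategy_corr] using h1
  constructor
  · intro hq
    have hdom := diagDominates_of_planar_optimal (M := G.gameMatrix) hs ht
      fun c d c' d' h h' => by
        have := hplane c d c' d' h h'
        rw [hq, hc] at this
        linarith
    have hσ := hdom.left_pos hrow
    have hτ := hdom.transpose.left_pos hcol
    refine ⟨Or.inl ⟨Matrix.PosDef.diagonal hσ, Matrix.PosDef.diagonal hτ⟩, le_antisymm ?_ ?_⟩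
    · exact (realSpectralRadius_le_one_iff _).2 fun k hk =>
        hdom.norm_le_one_of_mem_spectrum hσ hτ hk
    · exact one_le_realSpectralRadius (one_mem_spectrum_normalized hs ht hσ hτ)
  · rintro ⟨hdef, hρ⟩
    have hdef' : (G.sigmaMat sA sB).PosDef ∧ (G.lambdaMat sA sB).PosDef := by
      -- In the negative definite case the bias `C` would be negative, and flipping all of Alice's
      -- answers would improve it.
      refine hdef.resolve_right fun hneg => ?_
      have h1 := hneg.1
      rw [XorGame.sigmaMat, Matrix.diagonal_neg, Matrix.posDef_diagonal_iff] at h1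
      have h2 : C < 0 := by
        rw [← hσC]
        exact Finset.sum_neg (fun x _ => neg_pos.1 (h1 x)) Finset.univ_nonempty
      have h3 := hopt (fun x => !(α x)) β
      have h4 : ∀ b : Bool, bitSign (!b) = -bitSign b := fun b => by cases b <;> simp [bitSign]
      simp only [G.classicalWinProb_eq, h4, ← hsA, ← hsB, neg_mul, mul_neg,
        Finset.sum_neg_distrib, ← hC] at h3
      linarith
    have hσ := Matrix.posDef_diagonal_iff.1 hdef'.1
    have hτ := Matrix.posDef_diagonal_iff.1 hdef'.2
    have hdom := diagDominates_of_norm_le_one hσ hτ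
      ((realSpectralRadius_le_one_iff _).1 hρ.le)
    rw [hc]
    refine le_antisymm ?_ ?_
    · refine csSup_le ⟨_, 2, 2, qubitStrategy 1 0 1 0 (by simp) (by simp), rfl⟩ ?_
      rintro _ ⟨dA, dB, S, rfl⟩
      have h1 := hdom.sum_mul_corr_le S
      rw [hσC, hτC] at h1
      rw [G.quantumWinProb_eq]
      linarith
    -- The classical strategy itself, as planar vectors lying on one axis.
    · have h1 := hplane sA 0 sB 0 (fun x => by simp [pow_two, hs]) (fun y => by simp [pow_two, ht])
      simpa [hC] using h1
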